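/- **Setting.** An operational theory is a symmetric monoidal category whose objects are system types and whose morphisms are events (single outcomes of processes); tests are the finite families of events labelled by the outcomes of one process. Every event occurs in a test; wires and their rearrangements are single-outcome (deterministic) tests; tests are closed under sequential and parallel composition, coarse-graining and randomisation (performing the $x$-th of several processes with probability $p_x$). Every closed circuit $s:I\to I$ has a probability $\ge 0$; these probabilities are multiplicative and sum to $1$ over the outcomes of a closed test, and events with the same probabilities in all closed circuits are identified. Every preparation event is a normalised state times a nonnegative number, and the states of each system span a finite-dimensional real vector space. A *state* is a deterministic event $I\to A$; it is *pure* if, whenever it is the coarse-graining of a preparation test, all events of that test are multiples of it. A deterministic event is *reversible* if it has a deterministic two-sided inverse. States $|s_1),\dots,|s_n)$ of $A$ are *perfectly distinguishable* if some measurement $\{(e_j|\}_{j=1}^n$ on $A$ satisfies $(e_j|s_i)=\delta_{ij}$. **Theorem.** Suppose that an operational theory satisfies: 1. *Causality*: each system has a unique deterministic effect, and the effects of every measurement sum to it. 2. *Purification*: every state of any system $A$ is the marginal on $A$ (obtained by applying the deterministic effect to $B$) of a pure state of $A\otimes B$ for some system $B$; and any two pure states of $A\otimes B$ with the same marginal on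 $A$ are related by a reversible transformation of $B$. 3. *Strong symmetry*: for any two $n$-tuples $(|\rho_i))$, $(|\sigma_i))$ of pure perfectly distinguishable states of the same system there is a reversible transformation $U$ with $U|\rho_i)=|\sigma_i)$ for all $i$. 4. The composite of two pure states is pure. Let $n\ge 1$, let $|1),\dots,|n)$ be pure perfectly distinguishable states of a system $A$ (the control), and let $T_1,\dots,T_n$ be reversible transformations from a system $B$ to a system $B'$ (in particular $B'=B$ is allowed). Then there is a reversible transformation $C\{T_i\}$ from $A\otimes B$ to $A\otimes B'$ such that $$C\{T_i\}\,\big(|i)\otimes|\sigma)\big)=|i)\otimes T_i|\sigma)\qquad\text{for all } i=1,\dots,n \text{ and all states } |\sigma) \text{ of } B .$$ -/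

import Mathlib

open CategoryTheory MonoidalCategory

universe v u

/-- Closed circuits define probabilities. Objects of `C` are system types, a morphism `A ⟶ B` is an
event (one pointer outcome of a process) with input `A` and output `B`, composition is sequential
composition, `⊗` is parallel composition, and a morphism `𝟙_ C ⟶ 𝟙_ C` is a closed circuit. -/
structure CircuitProbability (C : Type u) [Category.{v} C] [MonoidalCategory C] where
  prob : (𝟙_ C ⟶ 𝟙_ C) → ℝ

namespace CircuitProbability

variable {C : Type u} [Category.{v} C] [MonoidalCategory C] (P : CircuitProbability C)

/-- Probability of the closed circuit that results from inserting the event `f` into the circuit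
with preparation event `ρ` and effect `e`, where `R` is an arbitrary side system. -/
def circuit {A B R : C} (ρ : 𝟙_ C ⟶ A ⊗ R) (f : A ⟶ B) (e : B ⊗ R ⟶ 𝟙_ C) : ℝ :=
  P.prob (ρ ≫ (f ▷ R) ≫ e)

/-- `g = ∑ x, f x`, as an identity between probabilities of all closed circuits. -/
def IsSum {A B : C} {X : Type} [Fintype X] (f : X → (A ⟶ B)) (g : A ⟶ B) : Prop :=
  ∀ (R : C) (ρ : 𝟙_ C ⟶ A ⊗ R) (e : B ⊗ R ⟶ 𝟙_ C),
    P.circuit ρ g e = ∑ x, P.circuit ρ (f x) e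

/-- `f = c • g`, as an identity between probabilities of all closed circuits. -/
def IsMultiple {A B : C} (c : ℝ) (f g : A ⟶ B) : Prop :=
  ∀ (R : C) (ρ : 𝟙_ C ⟶ A ⊗ R) (e : B ⊗ R ⟶ 𝟙_ C),
    P.circuit ρ f e = c * P.circuit ρ g e

/-- A preparation event of `A` as a vector: its probabilities against all effects on `A`. -/
def stateVector {A : C} (ρ : 𝟙_ C ⟶ A) : (A ⟶ 𝟙_ C) → ℝ := fun e => P.prob (ρ ≫ e)

end CircuitProbability

/-- An operational theory. A test is the finite family of events labelled by the positions of the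
classical pointer of one process. Nothing is assumed here about causality or local tomography. -/
structure OperationalTheory (C : Type u) [Category.{v} C] [MonoidalCategory C]
    [SymmetricCategory C] extends CircuitProbability C where
  IsTest : ∀ {A B : C} {X : Type} [Fintype X], (X → (A ⟶ B)) → Prop
  /-- every event is an outcome of some process -/
  exists_test : ∀ {A B : C} (f : A ⟶ B),
    ∃ (X : Type) (_ : Fintype X) (t : X → (A ⟶ B)), IsTest t ∧ ∃ x, t x = f
  /-- wires, and their rearrangements, are processes with a single outcome -/
  test_id : ∀ A : C, IsTest (fun _ : Unit => 𝟙 A)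
  test_associator_hom : ∀ A B D : C, IsTest (fun _ : Unit => (α_ A B D).hom)
  test_associator_inv : ∀ A B D : C, IsTest (fun _ : Unit => (α_ A B D).inv)
  test_leftUnitor_hom : ∀ A : C, IsTest (fun _ : Unit => (λ_ A).hom)
  test_leftUnitor_inv : ∀ A : C, IsTest (fun _ : Unit => (λ_ A).inv)
  test_rightUnitor_hom : ∀ A : C, IsTest (fun _ : Unit => (ρ_ A).hom)
  test_rightUnitor_inv : ∀ A : C, IsTest (fun _ : Unit => (ρ_ A).inv)
  test_braiding : ∀ A B : C, IsTest (fun _ : Unit => (β_ A B).hom)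
  /-- sequential composition of processes -/
  test_comp : ∀ {A B D : C} {X Y : Type} [Fintype X] [Fintype Y]
    {f : X → (A ⟶ B)} {g : Y → (B ⟶ D)}, IsTest f → IsTest g →
    IsTest (fun p : X × Y => f p.1 ≫ g p.2)
  /-- parallel composition of processes -/
  test_tensor : ∀ {A A' B B' : C} {X Y : Type} [Fintype X] [Fintype Y]
    {f : X → (A ⟶ A')} {g : Y → (B ⟶ B')}, IsTest f → IsTest g →
    IsTest (fun p : X × Y => f p.1 ⊗ₘ g p.2)
  /-- coarse-graining along the partition of the outcomes into the fibres of `k` -/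
  test_coarse : ∀ {A B : C} {X Y : Type} [Fintype X] [Fintype Y] [DecidableEq Y]
    {f : X → (A ⟶ B)} (k : X → Y), Function.Surjective k → IsTest f →
    ∃ g : Y → (A ⟶ B), IsTest g ∧
      ∀ y, toCircuitProbability.IsSum (fun x : {x : X // k x = y} => f x.1) (g y)
  /-- randomisation: perform the process `f x` with probability `p x` -/
  test_randomize : ∀ {A B : C} {X Y : Type} [Fintype X] [Fintype Y]
    (p : X → ℝ) (f : X → Y → (A ⟶ B)), (∀ x, 0 ≤ p x) → ∑ x, p x = 1 →
    (∀ x, IsTest (f x)) →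
    ∃ g : X × Y → (A ⟶ B), IsTest g ∧
      ∀ x y, toCircuitProbability.IsMultiple (p x) (g (x, y)) (f x y)
  /-- every preparation event is a normalised state weighted by a probability -/
  normalize : ∀ {A : C} (ρ : 𝟙_ C ⟶ A), ∃ (c : ℝ) (σ : 𝟙_ C ⟶ A),
    IsTest (fun _ : Unit => σ) ∧ toCircuitProbability.IsMultiple c ρ σ
  prob_nonneg : ∀ s : 𝟙_ C ⟶ 𝟙_ C, 0 ≤ prob s
  /-- the outcome probabilities of a closed experiment sum to one -/
  prob_sum : ∀ {X : Type} [Fintype X] {s : X → (𝟙_ C ⟶ 𝟙_ C)}, IsTest s → ∑ x, prob (s x) = 1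
  /-- independent closed circuits have independent outcomes -/
  prob_comp : ∀ s t : 𝟙_ C ⟶ 𝟙_ C, prob (s ≫ t) = prob s * prob t
  /-- events with the same probabilities in all closed circuits are identified -/
  identify : ∀ {A B : C} (f g : A ⟶ B),
    (∀ (R : C) (ρ : 𝟙_ C ⟶ A ⊗ R) (e : B ⊗ R ⟶ 𝟙_ C),
      toCircuitProbability.circuit ρ f e = toCircuitProbability.circuit ρ g e) → f = g
  /-- the states of a system span a finite-dimensional real vector space -/
  finiteDimensional : ∀ A : C, FiniteDimensional ℝ (Submodule.span ℝ
    (Set.range (toCircuitProbability.stateVector : (𝟙_ C ⟶ A) → (A ⟶ 𝟙_ C) → ℝ)))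

namespace OperationalTheory

variable {C : Type u} [Category.{v} C] [MonoidalCategory C] [SymmetricCategory C]
  (T : OperationalTheory C)

/-- A process with a single pointer position. -/
def IsDeterministic {A B : C} (f : A ⟶ B) : Prop := T.IsTest (fun _ : Unit => f)

/-- A (normalised) state of `A`. -/
def IsState {A : C} (ρ : 𝟙_ C ⟶ A) : Prop := T.IsDeterministic ρ

/-- A deterministic process with a deterministic two-sided inverse. -/
def IsReversible {A B : C} (f : A ⟶ B) : Prop :=
  T.IsDeterministic f ∧ ∃ g : B ⟶ A, T.IsDeterministic g ∧ f ≫ g = 𝟙 A ∧ g ≫ f = 𝟙 B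

/-- A state is pure if it is a coarse-graining only of multiples of itself. -/
def IsPure {A : C} (ρ : 𝟙_ C ⟶ A) : Prop :=
  T.IsState ρ ∧ ∀ (X : Type) [Fintype X] (f : X → (𝟙_ C ⟶ A)),
    T.IsTest f → T.IsSum f ρ → ∀ x, ∃ c : ℝ, T.IsMultiple c (f x) ρ

/-- The product state `|ρ) ⊗ |σ)`. -/
def prodState {A B : C} (ρ : 𝟙_ C ⟶ A) (σ : 𝟙_ C ⟶ B) : 𝟙_ C ⟶ A ⊗ B :=
  (λ_ (𝟙_ C)).inv ≫ (ρ ⊗ₘ σ)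

/-- A measurement with `n` outcomes tells the `n` states apart with certainty. -/
def PerfectlyDistinguishable {A : C} {n : ℕ} (s : Fin n → (𝟙_ C ⟶ A)) : Prop :=
  ∃ e : Fin n → (A ⟶ 𝟙_ C), T.IsTest e ∧
    ∀ i j, T.prob (s i ≫ e j) = if i = j then 1 else 0

/-- `s` results from `ψ` by applying the deterministic effect to the second subsystem. -/
def IsMarginal {A B : C} (ψ : 𝟙_ C ⟶ A ⊗ B) (s : 𝟙_ C ⟶ A) : Prop :=
  ∃ d : B ⟶ 𝟙_ C, T.IsDeterministic d ∧ ψ ≫ (A ◁ d) ≫ (ρ_ A).hom = s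

/-- `ψ` is a purification of `s` with purifying system `B`. -/
def IsPurification {A B : C} (ψ : 𝟙_ C ⟶ A ⊗ B) (s : 𝟙_ C ⟶ A) : Prop :=
  T.IsPure ψ ∧ T.IsMarginal ψ s

/-- Every system has a unique deterministic effect, and the effects of every measurement on it
sum to that effect. -/
def Causality : Prop :=
  ∀ A : C, ∃ d : A ⟶ 𝟙_ C, T.IsDeterministic d ∧
    (∀ d' : A ⟶ 𝟙_ C, T.IsDeterministic d' → d' = d) ∧
    ∀ (X : Type) [Fintype X] (e : X → (A ⟶ 𝟙_ C)), T.IsTest e → T.IsSum e d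

/-- Every state has a purification, and two purifications of the same state with the same purifying
system differ by a reversible transformation of the purifying system. -/
def Purification : Prop :=
  (∀ (A : C) (s : 𝟙_ C ⟶ A), T.IsState s →
    ∃ (B : C) (ψ : 𝟙_ C ⟶ A ⊗ B), T.IsPurification ψ s) ∧
  ∀ (A B : C) (s : 𝟙_ C ⟶ A) (ψ ψ' : 𝟙_ C ⟶ A ⊗ B),
    T.IsPurification ψ s → T.IsPurification ψ' s →
    ∃ U : B ⟶ B, T.IsReversible U ∧ ψ ≫ (A ◁ U) = ψ'

/-- Any two `n`-tuples of pure perfectly distinguishable states of a system are related by a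
reversible transformation. -/
def StrongSymmetry : Prop :=
  ∀ (A : C) (n : ℕ) (s s' : Fin n → (𝟙_ C ⟶ A)),
    (∀ i, T.IsPure (s i)) → T.PerfectlyDistinguishable s →
    (∀ i, T.IsPure (s' i)) → T.PerfectlyDistinguishable s' →
    ∃ U : A ⟶ A, T.IsReversible U ∧ ∀ i, s i ≫ U = s' i

/-- The composite of two pure states is pure. -/
def PureComposites : Prop :=
  ∀ (A B : C) (s : 𝟙_ C ⟶ A) (t : 𝟙_ C ⟶ B),
    T.IsPure s → T.IsPure t → T.IsPure (prodState s t)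

/-- `K` is a controlled transformation for the control states `ctrl i` and the transformations
`F i` of the target. -/
def IsControlled {A B B' : C} {n : ℕ} (ctrl : Fin n → (𝟙_ C ⟶ A)) (F : Fin n → (B ⟶ B'))
    (K : A ⊗ B ⟶ A ⊗ B') : Prop :=
  ∀ (i : Fin n) (σ : 𝟙_ C ⟶ B), T.IsState σ →
    prodState (ctrl i) σ ≫ K = prodState (ctrl i) (σ ≫ F i)

end OperationalTheory

/-! The controlled process is extracted from one coherent instance of it. Take `B' = B`; the general
case follows by composing with the inverse of one `F i`. Purify the uniform mixture of the control
states to `ψ` on `E ⊗ A`, and choose a pure `Φ` on `B ⊗ R` from which effects on `R` steer a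
spanning family of states of `B` (`exists_steering_purification`). Strong symmetry gives a
reversible `U` on `A ⊗ (B ⊗ R)` that sends `ctrl i ⊗ Φ` to `ctrl i ⊗ (F i)Φ`, since both families
are pure and can be told apart on `A`.

`U` may touch `R`, but it leaves the marginal of `ψ ⊗ Φ` on `E ⊗ R` unchanged
(`marginal_controlled_eq`). Indeed, outcome `j` on `A` after `U` leaves `B ⊗ R` in the pure state
`(F j)Φ`, hence uncorrelated with `E` (`exists_stateVector_eq_prodState`); discarding `B` erases `F
j`, and the sum over `j` restores the marginal on `E`, which `U` does not affect. Uniqueness of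
purification then yields a reversible `K` on `A ⊗ B` alone with the same action as `U` on `ψ ⊗ Φ`.
Effects on `E` and `R` commute with `K` and select each control state and each steered state;
linearity in the target state does the rest, without local tomography. -/

namespace OperationalTheory

/-! ### Product states and effects in a monoidal category -/

section Diagrams

variable {C : Type u} [Category.{v} C] [MonoidalCategory C]

lemma prodState_eq_right {A B : C} (s : 𝟙_ C ⟶ A) (t : 𝟙_ C ⟶ B) :
    prodState s t = t ≫ (λ_ B).inv ≫ s ▷ B := by
  rw [prodState, tensorHom_def']; monoidal

lemma prodState_eq_left {A B : C} (s : 𝟙_ C ⟶ A) (t : 𝟙_ C ⟶ B) :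
    prodState s t = s ≫ (ρ_ A).inv ≫ A ◁ t := by
  rw [prodState, MonoidalCategory.tensorHom_def]; monoidal

lemma prodState_tensor {A B A' B' : C} (s : 𝟙_ C ⟶ A) (t : 𝟙_ C ⟶ B) (f : A ⟶ A') (g : B ⟶ B') :
    prodState s t ≫ (f ⊗ₘ g) = prodState (s ≫ f) (t ≫ g) := by
  simp [prodState]

lemma prodState_whiskerRight {A B A' : C} (s : 𝟙_ C ⟶ A) (t : 𝟙_ C ⟶ B) (f : A ⟶ A') :
    prodState s t ≫ f ▷ B = prodState (s ≫ f) t := by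
  simpa using prodState_tensor s t f (𝟙 B)

lemma prodState_whiskerLeft {A B B' : C} (s : 𝟙_ C ⟶ A) (t : 𝟙_ C ⟶ B) (g : B ⟶ B') :
    prodState s t ≫ A ◁ g = prodState s (t ≫ g) := by
  simpa using prodState_tensor s t (𝟙 A) g

lemma prodState_leftUnitor {B : C} (s : 𝟙_ C ⟶ 𝟙_ C) (t : 𝟙_ C ⟶ B) :
    prodState s t ≫ (λ_ B).hom = s ≫ t := by
  rw [prodState_eq_left]
  monoidal

lemma prodState_rightUnitor {A : C} (s : 𝟙_ C ⟶ A) (t : 𝟙_ C ⟶ 𝟙_ C) :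
    prodState s t ≫ (ρ_ A).hom = t ≫ s := by
  rw [prodState_eq_right]
  monoidal

lemma prodState_effect_left {A B : C} (s : 𝟙_ C ⟶ A) (t : 𝟙_ C ⟶ B) (e : A ⟶ 𝟙_ C) :
    prodState s t ≫ e ▷ B ≫ (λ_ B).hom = (s ≫ e) ≫ t := by
  rw [← Category.assoc, prodState_whiskerRight, prodState_leftUnitor]

lemma prodState_effect_right {A B : C} (s : 𝟙_ C ⟶ A) (t : 𝟙_ C ⟶ B) (e : B ⟶ 𝟙_ C) :
    prodState s t ≫ A ◁ e ≫ (ρ_ A).hom = (t ≫ e) ≫ s := by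
  rw [← Category.assoc, prodState_whiskerLeft, prodState_rightUnitor]

lemma associator_effect_left {E A X : C} (b : E ⟶ 𝟙_ C) :
    (α_ E A X).hom ≫ b ▷ (A ⊗ X) ≫ (λ_ (A ⊗ X)).hom = (b ▷ A ≫ (λ_ A).hom) ▷ X := by
  monoidal

lemma whiskerLeft_effect_left {E A B : C} (b : E ⟶ 𝟙_ C) (f : A ⟶ B) :
    E ◁ f ≫ b ▷ B ≫ (λ_ B).hom = (b ▷ A ≫ (λ_ A).hom) ≫ f := by
  rw [whisker_exchange_assoc, leftUnitor_naturality, Category.assoc]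

lemma braiding_effect_right [SymmetricCategory C] {X E : C} (b : E ⟶ 𝟙_ C) :
    (β_ E X).hom ≫ X ◁ b ≫ (ρ_ X).hom = b ▷ X ≫ (λ_ X).hom := by
  rw [← BraidedCategory.braiding_naturality_left_assoc, braiding_rightUnitor]

lemma braiding_effect_left [SymmetricCategory C] {X E : C} (b : E ⟶ 𝟙_ C) :
    (β_ X E).hom ≫ b ▷ X ≫ (λ_ X).hom = X ◁ b ≫ (ρ_ X).hom := by
  rw [← BraidedCategory.braiding_naturality_right_assoc, braiding_leftUnitor]

end Diagrams

/-! ### Linearity of processes, deterministic and reversible processes -/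

section Tests

variable {C : Type u} [Category.{v} C] [MonoidalCategory C] [SymmetricCategory C]
  (T : OperationalTheory C)

/-- Precomposing effects with `f` is a linear operation on functions of effects, so every process
acts linearly on state vectors. All later arguments with mixtures rest on this. -/
lemma stateVector_comp {A B : C} (s : 𝟙_ C ⟶ A) (f : A ⟶ B) :
    T.stateVector (s ≫ f) = LinearMap.funLeft ℝ ℝ (fun e : B ⟶ 𝟙_ C => f ≫ e) (T.stateVector s) := by
  ext e
  simp [CircuitProbability.stateVector, LinearMap.funLeft_apply]

/-- The input of a preparation event is trivial, so a side system can only carry an independent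
preparation, which is absorbed into the effect. Hence identification of events needs no side system
here. -/
lemma stateVector_injective {A : C} :
    Function.Injective (T.stateVector : (𝟙_ C ⟶ A) → (A ⟶ 𝟙_ C) → ℝ) := by
  intro s t h
  refine T.identify s t fun R ρ e => ?_
  have key : ∀ w : 𝟙_ C ⟶ A, ρ ≫ w ▷ R ≫ e = w ≫ (ρ_ A).inv ≫ A ◁ (ρ ≫ (λ_ R).hom) ≫ e := by
    intro w
    have h1 := prodState_eq_left w (ρ ≫ (λ_ R).hom)
    rw [prodState_eq_right] at h1
    have h2 := congrArg (· ≫ e) h1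
    simpa using h2
  have := congrFun h ((ρ_ A).inv ≫ A ◁ (ρ ≫ (λ_ R).hom) ≫ e)
  simpa only [CircuitProbability.circuit, CircuitProbability.stateVector, key] using this

lemma stateVector_of_isSum {T : OperationalTheory C} {A : C} {X : Type} [Fintype X]
    {f : X → (𝟙_ C ⟶ A)} {g : 𝟙_ C ⟶ A} (h : T.IsSum f g) :
    T.stateVector g = ∑ x, T.stateVector (f x) := by
  ext e
  have key : ∀ w : 𝟙_ C ⟶ A,
      (λ_ (𝟙_ C)).inv ≫ w ▷ 𝟙_ C ≫ (ρ_ A).hom ≫ e = w ≫ e := by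
    intro w; monoidal
  have := h (𝟙_ C) (λ_ (𝟙_ C)).inv ((ρ_ A).hom ≫ e)
  simpa only [CircuitProbability.circuit, key, CircuitProbability.stateVector,
    Finset.sum_apply] using this

lemma stateVector_of_isMultiple {T : OperationalTheory C} {A : C} {c : ℝ}
    {f g : 𝟙_ C ⟶ A} (h : T.IsMultiple c f g) :
    T.stateVector f = c • T.stateVector g := by
  ext e
  have key : ∀ w : 𝟙_ C ⟶ A,
      (λ_ (𝟙_ C)).inv ≫ w ▷ 𝟙_ C ≫ (ρ_ A).hom ≫ e = w ≫ e := by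
    intro w; monoidal
  have := h (𝟙_ C) (λ_ (𝟙_ C)).inv ((ρ_ A).hom ≫ e)
  simpa only [CircuitProbability.circuit, key, CircuitProbability.stateVector,
    Pi.smul_apply, smul_eq_mul] using this

lemma stateVector_scalar_comp {A : C} (c : 𝟙_ C ⟶ 𝟙_ C) (s : 𝟙_ C ⟶ A) :
    T.stateVector (c ≫ s) = T.prob c • T.stateVector s := by
  ext e
  simp [CircuitProbability.stateVector, T.prob_comp]

lemma stateVector_comp_of_eq_smul {A B : C} {c : ℝ} {s t : 𝟙_ C ⟶ A}
    (h : T.stateVector s = c • T.stateVector t) (f : A ⟶ B) :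
    T.stateVector (s ≫ f) = c • T.stateVector (t ≫ f) := by
  rw [stateVector_comp, h, map_smul, ← stateVector_comp]

lemma stateVector_comp_of_eq_sum {A B : C} {X : Type} [Fintype X] {c : X → ℝ} {s : 𝟙_ C ⟶ A}
    {t : X → (𝟙_ C ⟶ A)} (h : T.stateVector s = ∑ x, c x • T.stateVector (t x)) (f : A ⟶ B) :
    T.stateVector (s ≫ f) = ∑ x, c x • T.stateVector (t x ≫ f) := by
  rw [stateVector_comp, h, map_sum]
  exact Finset.sum_congr rfl fun x _ => by rw [map_smul, ← stateVector_comp]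

lemma stateVector_prodState_of_eq_smul_left {A B : C} {c : ℝ} {s s' : 𝟙_ C ⟶ A}
    (h : T.stateVector s = c • T.stateVector s') (t : 𝟙_ C ⟶ B) :
    T.stateVector (prodState s t) = c • T.stateVector (prodState s' t) := by
  rw [prodState_eq_left, prodState_eq_left]
  exact T.stateVector_comp_of_eq_smul h _

lemma stateVector_prodState_of_eq_smul_right {A B : C} {c : ℝ} {t t' : 𝟙_ C ⟶ B}
    (s : 𝟙_ C ⟶ A) (h : T.stateVector t = c • T.stateVector t') :
    T.stateVector (prodState s t) = c • T.stateVector (prodState s t') := by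
  rw [prodState_eq_right, prodState_eq_right]
  exact T.stateVector_comp_of_eq_smul h _

lemma stateVector_prodState_of_eq_sum_left {A B : C} {X : Type} [Fintype X] {c : X → ℝ}
    {s : 𝟙_ C ⟶ A} {s' : X → (𝟙_ C ⟶ A)}
    (h : T.stateVector s = ∑ x, c x • T.stateVector (s' x)) (t : 𝟙_ C ⟶ B) :
    T.stateVector (prodState s t) = ∑ x, c x • T.stateVector (prodState (s' x) t) := by
  simp only [prodState_eq_left]
  exact T.stateVector_comp_of_eq_sum h _

/-- Coarse-graining along a bijection has singleton fibres and changes only labels. This removes the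
`Unit` factors that composition of tests introduces. -/
lemma IsTest.reindex {T : OperationalTheory C} {A B : C} {X Y : Type} [Fintype X] [Fintype Y]
    {f : X → (A ⟶ B)} (hf : T.IsTest f) (k : Y ≃ X) : T.IsTest (fun y => f (k y)) := by
  classical
  obtain ⟨g, hg, hsum⟩ := T.test_coarse k.symm k.symm.surjective hf
  have : g = fun y => f (k y) := by
    funext y
    refine T.identify _ _ fun R ρ e => ?_
    rw [hsum y R ρ e]
    have hu : Unique {x : X // k.symm x = y} :=
      ⟨⟨⟨k y, by simp⟩⟩, fun a => Subtype.ext (by simp [← a.2])⟩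
    rw [Fintype.sum_subsingleton _ (⟨k y, by simp⟩ : {x : X // k.symm x = y})]
  rwa [← this]

variable {T}

lemma IsDeterministic.comp {A B D : C} {f : A ⟶ B} {g : B ⟶ D} (hf : T.IsDeterministic f)
    (hg : T.IsDeterministic g) : T.IsDeterministic (f ≫ g) :=
  (T.test_comp hf hg).reindex (Equiv.prodPUnit Unit).symm

lemma IsDeterministic.tensor {A B A' B' : C} {f : A ⟶ B} {g : A' ⟶ B'} (hf : T.IsDeterministic f)
    (hg : T.IsDeterministic g) : T.IsDeterministic (f ⊗ₘ g) :=
  (T.test_tensor hf hg).reindex (Equiv.prodPUnit Unit).symm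

lemma IsDeterministic.whiskerLeft {B B' : C} (A : C) {g : B ⟶ B'} (hg : T.IsDeterministic g) :
    T.IsDeterministic (A ◁ g) := by
  simpa using (show T.IsDeterministic (𝟙 A) from T.test_id A).tensor hg

lemma IsDeterministic.whiskerRight {B B' : C} {g : B ⟶ B'} (hg : T.IsDeterministic g) (A : C) :
    T.IsDeterministic (g ▷ A) := by
  simpa using hg.tensor (show T.IsDeterministic (𝟙 A) from T.test_id A)

lemma IsDeterministic.prodState {A B : C} {s : 𝟙_ C ⟶ A} {t : 𝟙_ C ⟶ B}
    (hs : T.IsDeterministic s) (ht : T.IsDeterministic t) : T.IsDeterministic (prodState s t) :=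
  IsDeterministic.comp (T.test_leftUnitor_inv _) (hs.tensor ht)

lemma IsReversible.comp {A B D : C} {f : A ⟶ B} {g : B ⟶ D} (hf : T.IsReversible f)
    (hg : T.IsReversible g) : T.IsReversible (f ≫ g) := by
  obtain ⟨hf, f', hf', h1, h2⟩ := hf
  obtain ⟨hg, g', hg', h3, h4⟩ := hg
  refine ⟨hf.comp hg, g' ≫ f', hg'.comp hf', ?_, ?_⟩
  · rw [Category.assoc, reassoc_of% h3, h1]
  · rw [Category.assoc, reassoc_of% h2, h4]

lemma IsReversible.whiskerLeft {B B' : C} (A : C) {g : B ⟶ B'} (hg : T.IsReversible g) :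
    T.IsReversible (A ◁ g) := by
  obtain ⟨hg, g', hg', h1, h2⟩ := hg
  exact ⟨hg.whiskerLeft A, A ◁ g', hg'.whiskerLeft A, by rw [← whiskerLeft_comp, h1, whiskerLeft_id],
    by rw [← whiskerLeft_comp, h2, whiskerLeft_id]⟩

lemma IsReversible.whiskerRight {B B' : C} {g : B ⟶ B'} (hg : T.IsReversible g) (A : C) :
    T.IsReversible (g ▷ A) := by
  obtain ⟨hg, g', hg', h1, h2⟩ := hg
  exact ⟨hg.whiskerRight A, g' ▷ A, hg'.whiskerRight A, by rw [← comp_whiskerRight, h1, id_whiskerRight],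
    by rw [← comp_whiskerRight, h2, id_whiskerRight]⟩

variable (T) in
lemma isReversible_associator_hom (A B D : C) : T.IsReversible (α_ A B D).hom :=
  ⟨T.test_associator_hom A B D, _, T.test_associator_inv A B D, by simp, by simp⟩

variable (T) in
lemma isReversible_associator_inv (A B D : C) : T.IsReversible (α_ A B D).inv :=
  ⟨T.test_associator_inv A B D, _, T.test_associator_hom A B D, by simp, by simp⟩

variable (T) in
lemma isReversible_braiding (A B : C) : T.IsReversible (β_ A B).hom :=
  ⟨T.test_braiding A B, _, T.test_braiding B A, by simp, by simp⟩

/-- A decomposition of the image is pulled back along the inverse, where purity of `s` applies, and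
the proportionality is pushed forward again. -/
lemma IsPure.comp_reversible {A B : C} {s : 𝟙_ C ⟶ A} {f : A ⟶ B} (hs : T.IsPure s)
    (hf : T.IsReversible f) : T.IsPure (s ≫ f) := by
  obtain ⟨hf, g, hg, hfg, hgf⟩ := hf
  refine ⟨IsDeterministic.comp hs.1 hf, fun X _ t ht hsum x => ?_⟩
  have hsum' : T.IsSum (fun p : X × Unit => t p.1 ≫ g) s := by
    intro R ρ e
    have h := hsum R ρ (g ▷ R ≫ e)
    simp only [CircuitProbability.circuit] at h ⊢
    simp only [Fintype.sum_prod_type, Finset.univ_unique, Finset.sum_singleton]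
    have key : (s ≫ f) ▷ R ≫ g ▷ R ≫ e = s ▷ R ≫ e := by
      rw [← comp_whiskerRight_assoc, Category.assoc, hfg, Category.comp_id]
    rw [key] at h
    simpa only [comp_whiskerRight, Category.assoc] using h
  obtain ⟨c, hc⟩ := hs.2 _ _ (T.test_comp ht hg) hsum' (x, ())
  refine ⟨c, fun R ρ e => ?_⟩
  have h := hc R ρ (f ▷ R ≫ e)
  simp only [CircuitProbability.circuit] at h ⊢
  have key : (t x ≫ g) ▷ R ≫ f ▷ R ≫ e = t x ▷ R ≫ e := by
    rw [← comp_whiskerRight_assoc, Category.assoc, hgf, Category.comp_id]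
  rw [key] at h
  simpa only [comp_whiskerRight, Category.assoc] using h

end Tests

/-! ### Discarding systems and marginals -/

section Causality

variable {C : Type u} [Category.{v} C] [MonoidalCategory C] [SymmetricCategory C]
  {T : OperationalTheory C}

/-- The deterministic effect of a causal theory. -/
noncomputable def discard (hc : T.Causality) (A : C) : A ⟶ 𝟙_ C := (hc A).choose

lemma isDeterministic_discard (hc : T.Causality) (A : C) : T.IsDeterministic (discard hc A) :=
  (hc A).choose_spec.1

lemma eq_discard (hc : T.Causality) {A : C} {d : A ⟶ 𝟙_ C} (hd : T.IsDeterministic d) :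
    d = discard hc A :=
  (hc A).choose_spec.2.1 d hd

lemma isSum_discard (hc : T.Causality) {A : C} {X : Type} [Fintype X] {e : X → (A ⟶ 𝟙_ C)}
    (he : T.IsTest e) : T.IsSum e (discard hc A) :=
  (hc A).choose_spec.2.2 X e he

lemma comp_discard (hc : T.Causality) {A B : C} {f : A ⟶ B} (hf : T.IsDeterministic f) :
    f ≫ discard hc B = discard hc A :=
  eq_discard hc (hf.comp (isDeterministic_discard hc B))

lemma discard_unit (hc : T.Causality) : discard hc (𝟙_ C) = 𝟙 (𝟙_ C) :=
  (eq_discard hc (T.test_id _)).symm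

lemma state_comp_discard (hc : T.Causality) {A : C} {s : 𝟙_ C ⟶ A} (hs : T.IsState s) :
    s ≫ discard hc A = 𝟙 (𝟙_ C) := by
  rw [comp_discard hc hs, discard_unit]

variable (T) in
lemma prob_id : T.prob (𝟙 (𝟙_ C)) = 1 := by
  simpa using T.prob_sum (T.test_id (𝟙_ C))

lemma discard_tensor (hc : T.Causality) (A B : C) :
    discard hc (A ⊗ B) = discard hc A ▷ B ≫ (λ_ B).hom ≫ discard hc B :=
  (eq_discard hc (((isDeterministic_discard hc A).whiskerRight B).comp
    (IsDeterministic.comp (T.test_leftUnitor_hom B) (isDeterministic_discard hc B)))).symm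

/-- Deterministically discarding the left subsystem. -/
noncomputable def discardLeft (hc : T.Causality) (A B : C) : A ⊗ B ⟶ B :=
  discard hc A ▷ B ≫ (λ_ B).hom

/-- Deterministically discarding the right subsystem. -/
noncomputable def discardRight (hc : T.Causality) (A B : C) : A ⊗ B ⟶ A :=
  A ◁ discard hc B ≫ (ρ_ A).hom

lemma isDeterministic_discardLeft (hc : T.Causality) (A B : C) :
    T.IsDeterministic (discardLeft hc A B) :=
  ((isDeterministic_discard hc A).whiskerRight B).comp (T.test_leftUnitor_hom B)

lemma isDeterministic_discardRight (hc : T.Causality) (A B : C) :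
    T.IsDeterministic (discardRight hc A B) :=
  ((isDeterministic_discard hc B).whiskerLeft A).comp (T.test_rightUnitor_hom A)

lemma prodState_discardLeft (hc : T.Causality) {A B : C} {s : 𝟙_ C ⟶ A} (hs : T.IsState s)
    (t : 𝟙_ C ⟶ B) : prodState s t ≫ discardLeft hc A B = t := by
  rw [discardLeft, prodState_effect_left, state_comp_discard hc hs, Category.id_comp]

lemma prodState_discardRight (hc : T.Causality) {A B : C} (s : 𝟙_ C ⟶ A) {t : 𝟙_ C ⟶ B}
    (ht : T.IsState t) : prodState s t ≫ discardRight hc A B = s := by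
  rw [discardRight, prodState_effect_right, state_comp_discard hc ht, Category.id_comp]

lemma isMarginal_iff (hc : T.Causality) {A B : C} {ψ : 𝟙_ C ⟶ A ⊗ B} {s : 𝟙_ C ⟶ A} :
    T.IsMarginal ψ s ↔ ψ ≫ discardRight hc A B = s := by
  constructor
  · rintro ⟨d, hd, h⟩
    rwa [discardRight, ← eq_discard hc hd]
  · intro h
    exact ⟨_, isDeterministic_discard hc B, h⟩

lemma braiding_discardLeft (hc : T.Causality) (A B : C) :
    (β_ B A).hom ≫ discardLeft hc A B = discardRight hc B A :=
  braiding_effect_left _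

lemma braiding_discardRight (hc : T.Causality) (A B : C) :
    (β_ B A).hom ≫ discardRight hc A B = discardLeft hc B A :=
  braiding_effect_right _

/-- The effects of a measurement on the middle subsystem sum to discarding it. -/
lemma stateVector_discard_middle (hc : T.Causality) {E A X : C} {J : Type} [Fintype J]
    {e : J → (A ⟶ 𝟙_ C)} (he : T.IsTest e) (ω : 𝟙_ C ⟶ E ⊗ (A ⊗ X)) :
    T.stateVector (ω ≫ E ◁ discardLeft hc A X) =
      ∑ j, T.stateVector (ω ≫ E ◁ (e j ▷ X ≫ (λ_ X).hom)) := by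
  -- Permute `A` to the front, so that `X ⊗ E` becomes the side system in the definition of `IsSum`.
  have key : ∀ (a : A ⟶ 𝟙_ C) (g : E ⊗ X ⟶ 𝟙_ C),
      (ω ≫ E ◁ (a ▷ X ≫ (λ_ X).hom)) ≫ g =
        (ω ≫ (β_ E (A ⊗ X)).hom ≫ (α_ A X E).hom) ≫ a ▷ (X ⊗ E) ≫
          ((λ_ (X ⊗ E)).hom ≫ (β_ X E).hom ≫ g) := by
    intro a g
    have h1 : (α_ A X E).hom ≫ a ▷ (X ⊗ E) ≫ (λ_ (X ⊗ E)).hom = (a ▷ X ≫ (λ_ X).hom) ▷ E := by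
      monoidal
    have h2 := BraidedCategory.braiding_naturality_right E (a ▷ X ≫ (λ_ X).hom)
    simp only [Category.assoc]
    rw [reassoc_of% h1, ← reassoc_of% h2, SymmetricCategory.symmetry_assoc]
  ext g
  simp only [Finset.sum_apply, CircuitProbability.stateVector, discardLeft, key]
  exact isSum_discard hc he _ _ _

end Causality

/-! ### Uniqueness of purification; pure marginals exclude correlations -/

section Purification

variable {C : Type u} [Category.{v} C] [MonoidalCategory C] [SymmetricCategory C]
  {T : OperationalTheory C}

/-- Uniqueness of purifications whose purifying system `P` lies between two other systems. -/
lemma exists_reversible_middle (hc : T.Causality) (hp : T.Purification) {E P R : C}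
    {ψ ψ' : 𝟙_ C ⟶ E ⊗ (P ⊗ R)} (hψ : T.IsPure ψ) (hψ' : T.IsPure ψ')
    (h : ψ ≫ E ◁ discardLeft hc P R = ψ' ≫ E ◁ discardLeft hc P R) :
    ∃ U : P ⟶ P, T.IsReversible U ∧ ψ ≫ E ◁ (U ▷ R) = ψ' := by
  -- Moving `P` to the end exhibits both states as purifications of the same state of `E ⊗ R`.
  let π : E ⊗ (P ⊗ R) ⟶ (E ⊗ R) ⊗ P := E ◁ (β_ P R).hom ≫ (α_ E R P).inv
  have hπ : T.IsReversible π :=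
    ((T.isReversible_braiding P R).whiskerLeft E).comp (T.isReversible_associator_inv E R P)
  have hmarg : π ≫ discardRight hc (E ⊗ R) P = E ◁ discardLeft hc P R := by
    rw [← braiding_discardRight]
    simp only [π, discardRight]
    monoidal
  have hU : ∀ U : P ⟶ P, π ≫ (E ⊗ R) ◁ U = E ◁ (U ▷ R) ≫ π := by
    intro U
    simp only [π]
    rw [← whiskerLeft_comp_assoc, BraidedCategory.braiding_naturality_left]
    monoidal
  obtain ⟨U, hUrev, hUeq⟩ := hp.2 (E ⊗ R) P (ψ ≫ E ◁ discardLeft hc P R) (ψ ≫ π) (ψ' ≫ π)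
    ⟨hψ.comp_reversible hπ, (isMarginal_iff hc).2 (by rw [Category.assoc, hmarg])⟩
    ⟨hψ'.comp_reversible hπ, (isMarginal_iff hc).2 (by rw [Category.assoc, hmarg, h])⟩
  refine ⟨U, hUrev, ?_⟩
  obtain ⟨-, π', -, hππ', -⟩ := hπ
  have := congrArg (· ≫ π') hUeq
  simpa only [Category.assoc, hU, hππ', Category.comp_id] using this

/-- Uniqueness of purifications whose purifying system is on the left. -/
lemma exists_reversible_left (hc : T.Causality) (hp : T.Purification) {P X : C}
    {ψ ψ' : 𝟙_ C ⟶ P ⊗ X} (hψ : T.IsPure ψ) (hψ' : T.IsPure ψ')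
    (h : ψ ≫ discardLeft hc P X = ψ' ≫ discardLeft hc P X) :
    ∃ U : P ⟶ P, T.IsReversible U ∧ ψ ≫ U ▷ X = ψ' := by
  obtain ⟨U, hUrev, hUeq⟩ := hp.2 X P (ψ ≫ discardLeft hc P X)
    (ψ ≫ (β_ P X).hom) (ψ' ≫ (β_ P X).hom)
    ⟨hψ.comp_reversible (T.isReversible_braiding P X),
      (isMarginal_iff hc).2 (by rw [Category.assoc, braiding_discardRight])⟩
    ⟨hψ'.comp_reversible (T.isReversible_braiding P X),
      (isMarginal_iff hc).2 (by rw [Category.assoc, braiding_discardRight, h])⟩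
  refine ⟨U, hUrev, ?_⟩
  have := congrArg (· ≫ (β_ X P).hom) hUeq
  simpa only [Category.assoc, ← BraidedCategory.braiding_naturality_left_assoc,
    SymmetricCategory.symmetry, Category.comp_id] using this

/-- A pure state with pure marginal on `X` is a product state. -/
lemma exists_prodState_of_isPure (hc : T.Causality) (hp : T.Purification)
    (hpure : T.PureComposites) {Q X : C} {ψ : 𝟙_ C ⟶ Q ⊗ X} (hψ : T.IsPure ψ)
    (hφ : T.IsPure (ψ ≫ discardLeft hc Q X)) :
    ∃ κ : 𝟙_ C ⟶ Q, T.IsState κ ∧ ψ = prodState κ (ψ ≫ discardLeft hc Q X) := by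
  set φ := ψ ≫ discardLeft hc Q X
  have hψ' := hψ.comp_reversible (T.isReversible_braiding Q X)
  -- `ψ ⊗ φ` and `φ ⊗ ψ` both purify the state `φ` of the last `X`, with the same purifying system
  -- `X ⊗ Q`. In the first of them the last `X` is already uncorrelated.
  have h1 := hpure _ _ _ _ hψ' hφ
  have h2 := (hpure _ _ _ _ hφ hψ).comp_reversible (T.isReversible_associator_inv X Q X)
  have hd : (α_ X Q X).inv ≫ discardLeft hc (X ⊗ Q) X =
      discardLeft hc X (Q ⊗ X) ≫ discardLeft hc Q X := by
    rw [discardLeft, discard_tensor, discardLeft, discardLeft]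
    monoidal
  obtain ⟨V, hV, hVeq⟩ := exists_reversible_left hc hp h1 h2 (by
    rw [prodState_discardLeft hc hψ'.1, Category.assoc, hd, ← Category.assoc,
      prodState_discardLeft hc hφ.1])
  refine ⟨(ψ ≫ (β_ Q X).hom) ≫ V ≫ discardLeft hc X Q,
    hψ'.1.comp (hV.1.comp (isDeterministic_discardLeft hc X Q)), ?_⟩
  have h3 : (α_ X Q X).inv ≫ discardLeft hc X Q ▷ X = discardLeft hc X (Q ⊗ X) := by
    rw [discardLeft, discardLeft]
    monoidal
  -- Discarding the first `X` turns `φ ⊗ ψ` into `ψ`, and leaves the other side a product because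
  -- `V` acts on `X ⊗ Q` only.
  have h4 := congrArg (· ≫ discardLeft hc X Q ▷ X) hVeq
  simp only [Category.assoc, h3, prodState_discardLeft hc hφ.1] at h4
  refine h4.symm.trans ?_
  rw [← comp_whiskerRight, prodState_whiskerRight]

/-- A state with pure marginal on `X` is a product state. -/
lemma exists_prodState_of_isState (hc : T.Causality) (hp : T.Purification)
    (hpure : T.PureComposites) {E X : C} {σ : 𝟙_ C ⟶ E ⊗ X} (hσ : T.IsState σ)
    (hφ : T.IsPure (σ ≫ discardLeft hc E X)) :
    ∃ ε : 𝟙_ C ⟶ E, T.IsState ε ∧ σ = prodState ε (σ ≫ discardLeft hc E X) := by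
  obtain ⟨F, ψ, hψ, hm⟩ := hp.1 _ σ hσ
  rw [isMarginal_iff hc] at hm
  -- Group the purifying system with `E`: the purification is then a pure state with the same pure
  -- marginal on `X`, hence a product, and discarding `F` keeps it one.
  have hψ' := (hψ.comp_reversible (T.isReversible_braiding (E ⊗ X) F)).comp_reversible
    (T.isReversible_associator_inv F E X)
  have h1 : (α_ F E X).inv ≫ discardLeft hc F E ▷ X = discardLeft hc F (E ⊗ X) := by
    rw [discardLeft, discardLeft]
    monoidal
  have h2 : discardLeft hc (F ⊗ E) X = discardLeft hc F E ▷ X ≫ discardLeft hc E X := by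
    rw [discardLeft, discard_tensor, discardLeft, discardLeft]
    monoidal
  have h3 : ((ψ ≫ (β_ (E ⊗ X) F).hom) ≫ (α_ F E X).inv) ≫ discardLeft hc F E ▷ X = σ := by
    rw [Category.assoc, h1, Category.assoc, braiding_discardLeft, hm]
  have h4 : ((ψ ≫ (β_ (E ⊗ X) F).hom) ≫ (α_ F E X).inv) ≫ discardLeft hc (F ⊗ E) X =
      σ ≫ discardLeft hc E X := by
    rw [h2, ← Category.assoc, h3]
  obtain ⟨κ, hκ, hκeq⟩ := exists_prodState_of_isPure hc hp hpure hψ' (by rwa [h4])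
  refine ⟨κ ≫ discardLeft hc F E, hκ.comp (isDeterministic_discardLeft hc F E), ?_⟩
  rw [h4] at hκeq
  conv_lhs => rw [← h3, hκeq, prodState_whiskerRight]

/-- A preparation event whose marginal on `X` is proportional to a pure state is proportional to a
product state. -/
lemma exists_stateVector_eq_prodState (hc : T.Causality) (hp : T.Purification)
    (hpure : T.PureComposites) {E X : C} {η : 𝟙_ C ⟶ E ⊗ X} {φ : 𝟙_ C ⟶ X} (hφ : T.IsPure φ)
    {p : ℝ} (hp0 : p ≠ 0)
    (h : T.stateVector (η ≫ discardLeft hc E X) = p • T.stateVector φ) :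
    ∃ ε : 𝟙_ C ⟶ E, T.stateVector η = p • T.stateVector (prodState ε φ) := by
  obtain ⟨c, σ, hσ, hη⟩ := T.normalize η
  replace hη := stateVector_of_isMultiple hη
  have h1 := T.stateVector_comp_of_eq_smul hη (discardLeft hc E X)
  rw [h] at h1
  have hσd : T.IsState (σ ≫ discardLeft hc E X) :=
    IsDeterministic.comp hσ (isDeterministic_discardLeft hc E X)
  -- The deterministic effect reads off the weights of both sides.
  have hpc : p = c := by
    have h2 := congrFun h1 (discard hc X)
    simpa only [Pi.smul_apply, CircuitProbability.stateVector, state_comp_discard hc hφ.1,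
      state_comp_discard hc hσd, prob_id, smul_eq_mul, mul_one] using h2
  subst hpc
  have h3 : φ = σ ≫ discardLeft hc E X :=
    T.stateVector_injective (smul_right_injective _ hp0 h1)
  obtain ⟨ε, -, hε⟩ := exists_prodState_of_isState hc hp hpure hσ (h3 ▸ hφ)
  exact ⟨ε, by rw [h3, ← hε, hη]⟩

end Purification

/-! ### Classical registers and steering -/

section Steering

variable {C : Type u} [Category.{v} C] [MonoidalCategory C] [SymmetricCategory C]
  {T : OperationalTheory C}

/-- The uniform mixture of a nonempty finite family of states. -/
lemma exists_uniform_mixture {A : C} {m : ℕ} (hm : m ≠ 0) {s : Fin m → (𝟙_ C ⟶ A)}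
    (hs : ∀ k, T.IsState (s k)) :
    ∃ ω : 𝟙_ C ⟶ A, T.IsState ω ∧ T.stateVector ω = ∑ k, (m : ℝ)⁻¹ • T.stateVector (s k) := by
  have hm' : (m : ℝ) ≠ 0 := Nat.cast_ne_zero.2 hm
  obtain ⟨g, hg, hgm⟩ := T.test_randomize (fun _ : Fin m => (m : ℝ)⁻¹) (fun k (_ : Unit) => s k)
    (fun _ => by positivity) (by simp [hm']) hs
  have : NeZero m := ⟨hm⟩
  obtain ⟨w, hw, hsum⟩ := T.test_coarse (fun _ : Fin m × Unit => ()) (fun _ => ⟨(0, ()), rfl⟩) hg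
  refine ⟨w (), hw, ?_⟩
  rw [stateVector_of_isSum (hsum ()), ← (Equiv.subtypeUnivEquiv (fun _ => rfl)).symm.sum_comp,
    Fintype.sum_prod_type]
  refine Finset.sum_congr rfl fun k _ => ?_
  simpa using stateVector_of_isMultiple (hgm k ())

/-- A system with a pair of distinguishable states gives rise to systems with arbitrarily many
distinguishable states. -/
lemma exists_distinguishable_family (hc : T.Causality) {A : C} {s : Fin 2 → (𝟙_ C ⟶ A)}
    (hs : ∀ i, T.IsState (s i)) {e : Fin 2 → (A ⟶ 𝟙_ C)}
    (he : ∀ i j, T.prob (s i ≫ e j) = if i = j then 1 else 0) (m : ℕ) :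
    ∃ (S : C) (t : Fin m → (𝟙_ C ⟶ S)) (f : Fin m → (S ⟶ 𝟙_ C)), (∀ k, T.IsState (t k)) ∧
      ∀ k l, T.prob (t k ≫ f l) = if k = l then 1 else 0 := by
  have hprob : ∀ {S : C} (t : 𝟙_ C ⟶ S) (f : S ⟶ 𝟙_ C) (i j : Fin 2),
      T.prob (prodState t (s i) ≫ f ▷ A ≫ (λ_ A).hom ≫ e j) =
        if i = j then T.prob (t ≫ f) else 0 := by
    intro S t f i j
    have := prodState_effect_left t (s i) f
    simp only [← Category.assoc] at this ⊢
    rw [this, Category.assoc, T.prob_comp, he]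
    split_ifs <;> simp
  induction m with
  | zero => exact ⟨𝟙_ C, Fin.elim0, Fin.elim0, fun k => k.elim0, fun k => k.elim0⟩
  | succ m ih =>
    obtain ⟨S, t, f, ht, hf⟩ := ih
    -- The empty family has no `t 0` to tag, so the one-element family is taken from `A` itself.
    rcases Nat.eq_zero_or_pos m with rfl | hm
    · refine ⟨A, fun _ => s 0, fun _ => e 0, fun _ => hs 0, fun k l => ?_⟩
      rw [he, if_pos rfl, if_pos (by omega)]
    · let t₀ := t ⟨0, hm⟩
      -- The factor `A` is a flag: `s 0` marks the new state, `s 1` the old ones. The effects need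
      -- not form a test, since steering uses them one at a time.
      refine ⟨S ⊗ A, Fin.cons (prodState t₀ (s 0)) fun k => prodState (t k) (s 1),
        Fin.cons (discard hc S ▷ A ≫ (λ_ A).hom ≫ e 0) fun k => f k ▷ A ≫ (λ_ A).hom ≫ e 1,
        fun k => ?_, fun k l => ?_⟩
      · refine Fin.cases ?_ (fun k => ?_) k
        · exact (ht _).prodState (hs _)
        · exact (ht k).prodState (hs _)
      · refine Fin.cases ?_ (fun k => ?_) k <;> refine Fin.cases ?_ (fun l => ?_) l
        · simp only [Fin.cons_zero, hprob, t₀, state_comp_discard hc (ht _), prob_id, if_true]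
        · simp [hprob, (Fin.succ_ne_zero _).symm]
        · simp [hprob]
        · simp [hprob, hf]

/-- A purification from which every state of a finite family can be steered. -/
lemma exists_steering_purification (hc : T.Causality) (hp : T.Purification) {S B : C} {m : ℕ}
    (hm : m ≠ 0) {t : Fin m → (𝟙_ C ⟶ S)} {f : Fin m → (S ⟶ 𝟙_ C)} (ht : ∀ k, T.IsState (t k))
    (hf : ∀ k l, T.prob (t k ≫ f l) = if k = l then 1 else 0) {σ : Fin m → (𝟙_ C ⟶ B)}
    (hσ : ∀ k, T.IsState (σ k)) :
    ∃ (R : C) (Φ : 𝟙_ C ⟶ B ⊗ R) (g : Fin m → (R ⟶ 𝟙_ C)), T.IsPure Φ ∧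
      (∀ k, T.stateVector (Φ ≫ B ◁ g k ≫ (ρ_ B).hom) = (m : ℝ)⁻¹ • T.stateVector (σ k)) ∧
      T.stateVector (Φ ≫ discardRight hc B R) = ∑ k, (m : ℝ)⁻¹ • T.stateVector (σ k) := by
  -- The register `S` records which `σ k` was prepared. It becomes part of the purifying system,
  -- where `f k` selects that term.
  obtain ⟨ω, hω, hsum⟩ := exists_uniform_mixture hm fun k => (hσ k).prodState (ht k)
  obtain ⟨F, Φ, hΦ, hmarg⟩ := hp.1 _ ω hω
  rw [isMarginal_iff hc] at hmarg
  have hstep : ∀ h : S ⟶ 𝟙_ C,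
      (Φ ≫ (α_ B S F).hom) ≫ B ◁ (S ◁ discard hc F ≫ (ρ_ S).hom ≫ h) ≫ (ρ_ B).hom =
        ω ≫ B ◁ h ≫ (ρ_ B).hom := by
    intro h
    rw [← hmarg, discardRight]
    monoidal
  refine ⟨S ⊗ F, Φ ≫ (α_ B S F).hom, fun k => S ◁ discard hc F ≫ (ρ_ S).hom ≫ f k,
    hΦ.comp_reversible (T.isReversible_associator_hom B S F), fun k => ?_, ?_⟩
  · rw [hstep, T.stateVector_comp_of_eq_sum hsum]
    simp only [prodState_effect_right, stateVector_scalar_comp, hf]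
    simp
  · have hd : discard hc (S ⊗ F) = S ◁ discard hc F ≫ (ρ_ S).hom ≫ discard hc S :=
      (eq_discard hc (((isDeterministic_discard hc F).whiskerLeft S).comp
        (IsDeterministic.comp (T.test_rightUnitor_hom S) (isDeterministic_discard hc S)))).symm
    rw [discardRight, hd, hstep, T.stateVector_comp_of_eq_sum hsum]
    simp only [prodState_effect_right, state_comp_discard hc (ht _), Category.id_comp]

end Steering

/-! ### Construction of the controlled transformation -/

section Control

variable {C : Type u} [Category.{v} C] [MonoidalCategory C] [SymmetricCategory C]
  {T : OperationalTheory C}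

lemma PerfectlyDistinguishable.prodState (hc : T.Causality) {A X : C} {n : ℕ}
    {s : Fin n → (𝟙_ C ⟶ A)} (hs : T.PerfectlyDistinguishable s) {φ : Fin n → (𝟙_ C ⟶ X)}
    (hφ : ∀ i, T.IsState (φ i)) : T.PerfectlyDistinguishable fun i => prodState (s i) (φ i) := by
  obtain ⟨e, he, hes⟩ := hs
  refine ⟨fun j => discardRight hc A X ≫ e j,
    (T.test_comp (isDeterministic_discardRight hc A X) he).reindex (Equiv.punitProd (Fin n)).symm,
    fun i j => ?_⟩
  rw [← Category.assoc, prodState_discardRight hc _ (hφ i), hes]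

/-- The state prepared by a reversible transformation `U` that implements the control on the
purifications has the same marginal on the purifying systems as the state it started from. -/
lemma marginal_controlled_eq (hc : T.Causality) (hp : T.Purification) (hpure : T.PureComposites)
    {A B E R : C} {n : ℕ} (hn : n ≠ 0) {ctrl : Fin n → (𝟙_ C ⟶ A)}
    {e : Fin n → (A ⟶ 𝟙_ C)} (he : T.IsTest e)
    (hes : ∀ i j, T.prob (ctrl i ≫ e j) = if i = j then 1 else 0)
    {F : Fin n → (B ⟶ B)} (hF : ∀ i, T.IsReversible (F i))
    {ψ : 𝟙_ C ⟶ E ⊗ A}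
    (hψd : T.stateVector (ψ ≫ discardLeft hc E A) = ∑ i, (n : ℝ)⁻¹ • T.stateVector (ctrl i))
    {Φ : 𝟙_ C ⟶ B ⊗ R} (hΦ : T.IsPure Φ) {U : A ⊗ (B ⊗ R) ⟶ A ⊗ (B ⊗ R)}
    (hU : T.IsReversible U)
    (hUs : ∀ i, prodState (ctrl i) Φ ≫ U = prodState (ctrl i) (Φ ≫ F i ▷ R)) :
    (prodState ψ Φ ≫ (α_ E A (B ⊗ R)).hom) ≫ E ◁ U ≫
        E ◁ (discardLeft hc A (B ⊗ R) ≫ discardLeft hc B R) =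
      (prodState ψ Φ ≫ (α_ E A (B ⊗ R)).hom) ≫
        E ◁ (discardLeft hc A (B ⊗ R) ≫ discardLeft hc B R) := by
  have hn' : (n : ℝ)⁻¹ ≠ 0 := inv_ne_zero (Nat.cast_ne_zero.2 hn)
  set Ψ := prodState ψ Φ ≫ (α_ E A (B ⊗ R)).hom with hΨ
  set φ := Φ ≫ discardLeft hc B R
  have hφs : T.IsState φ := IsDeterministic.comp hΦ.1 (isDeterministic_discardLeft hc B R)
  have hΨd : Ψ ≫ discardLeft hc E (A ⊗ (B ⊗ R)) = prodState (ψ ≫ discardLeft hc E A) Φ := by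
    rw [hΨ, Category.assoc, discardLeft, associator_effect_left, prodState_whiskerRight]
    rfl
  have hright : Ψ ≫ E ◁ (discardLeft hc A (B ⊗ R) ≫ discardLeft hc B R) =
      prodState (ψ ≫ discardRight hc E A) φ := by
    have h1 : (α_ E A (B ⊗ R)).hom ≫ E ◁ discardLeft hc A (B ⊗ R) =
        discardRight hc E A ▷ (B ⊗ R) := by
      rw [discardLeft, discardRight]
      monoidal
    rw [hΨ, whiskerLeft_comp, Category.assoc, reassoc_of% h1, ← Category.assoc,
      prodState_whiskerRight, prodState_whiskerLeft]
  clear_value Ψ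
  -- The unnormalised state that remains after outcome `j` on the control.
  let η : Fin n → (𝟙_ C ⟶ E ⊗ (B ⊗ R)) := fun j =>
    (Ψ ≫ E ◁ U) ≫ E ◁ (e j ▷ (B ⊗ R) ≫ (λ_ (B ⊗ R)).hom)
  have hη : ∀ j, ∃ ε : 𝟙_ C ⟶ E,
      T.stateVector (η j) = (n : ℝ)⁻¹ • T.stateVector (prodState ε (Φ ≫ F j ▷ R)) := by
    intro j
    refine exists_stateVector_eq_prodState hc hp hpure
      (hΦ.comp_reversible ((hF j).whiskerRight R)) hn' ?_
    have h1 : η j ≫ discardLeft hc E (B ⊗ R) =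
        prodState (ψ ≫ discardLeft hc E A) Φ ≫ U ≫ e j ▷ (B ⊗ R) ≫ (λ_ (B ⊗ R)).hom := by
      rw [← hΨd]
      simp only [η, discardLeft]
      rw [Category.assoc, Category.assoc, ← whiskerLeft_comp_assoc, whiskerLeft_effect_left]
      simp only [Category.assoc]
    rw [h1, T.stateVector_comp_of_eq_sum (T.stateVector_prodState_of_eq_sum_left hψd Φ)]
    have h2 : ∀ i, prodState (ctrl i) Φ ≫ U ≫ e j ▷ (B ⊗ R) ≫ (λ_ (B ⊗ R)).hom =
        (ctrl i ≫ e j) ≫ Φ ≫ F i ▷ R := by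
      intro i
      rw [← Category.assoc, hUs, prodState_effect_left]
    simp only [h2, stateVector_scalar_comp, hes]
    simp
  choose ε hε using hη
  have hleft : T.stateVector ((Ψ ≫ E ◁ U) ≫ E ◁ (discardLeft hc A (B ⊗ R) ≫ discardLeft hc B R)) =
      ∑ j, (n : ℝ)⁻¹ • T.stateVector (prodState (ε j) φ) := by
    have h1 : T.stateVector ((Ψ ≫ E ◁ U) ≫ E ◁ discardLeft hc A (B ⊗ R)) =
        ∑ j, (n : ℝ)⁻¹ • T.stateVector (prodState (ε j) (Φ ≫ F j ▷ R)) := by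
      rw [stateVector_discard_middle hc he]
      exact Finset.sum_congr rfl fun j _ => hε j
    rw [whiskerLeft_comp, ← Category.assoc, T.stateVector_comp_of_eq_sum h1]
    refine Finset.sum_congr rfl fun j _ => ?_
    have h2 : F j ▷ R ≫ discardLeft hc B R = discardLeft hc B R := by
      rw [discardLeft, ← comp_whiskerRight_assoc, comp_discard hc (hF j).1]
    rw [prodState_whiskerLeft, Category.assoc, h2]
  -- Both sides are the marginal on `E` of the state after `U`: discarding the output of the
  -- deterministic `U` amounts to discarding its input.
  have hE : T.stateVector (ψ ≫ discardRight hc E A) = ∑ j, (n : ℝ)⁻¹ • T.stateVector (ε j) := by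
    have h1 := T.stateVector_comp_of_eq_sum hleft (discardRight hc E R)
    simp only [prodState_discardRight hc _ hφs] at h1
    rw [← h1, ← prodState_discardRight hc (ψ ≫ discardRight hc E A) hφs, ← hright]
    have h2 : ∀ {Y : C} {f : Y ⟶ R} (_ : T.IsDeterministic f),
        E ◁ f ≫ discardRight hc E R = discardRight hc E Y := by
      intro Y f hf
      rw [discardRight, ← whiskerLeft_comp_assoc, comp_discard hc hf, discardRight]
    have hd : T.IsDeterministic (discardLeft hc A (B ⊗ R) ≫ discardLeft hc B R) :=
      (isDeterministic_discardLeft hc A (B ⊗ R)).comp (isDeterministic_discardLeft hc B R)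
    rw [Category.assoc, Category.assoc, Category.assoc, h2 hd, discardRight,
      ← whiskerLeft_comp_assoc, comp_discard hc hU.1]
  apply T.stateVector_injective
  rw [← Category.assoc, hleft, hright, T.stateVector_prodState_of_eq_sum_left hE]

/-- The controlled transformation acts as required on all states that can be steered. -/
lemma exists_controlled_of_steering (hc : T.Causality) (hp : T.Purification)
    (hsymm : T.StrongSymmetry) (hpure : T.PureComposites)
    {A B : C} {n : ℕ} (hn : n ≠ 0) {ctrl : Fin n → (𝟙_ C ⟶ A)} (hctrl : ∀ i, T.IsPure (ctrl i))
    (hdist : T.PerfectlyDistinguishable ctrl) {F : Fin n → (B ⟶ B)}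
    (hF : ∀ i, T.IsReversible (F i)) {R : C} {Φ : 𝟙_ C ⟶ B ⊗ R} (hΦ : T.IsPure Φ) :
    ∃ K : A ⊗ B ⟶ A ⊗ B, T.IsReversible K ∧ ∀ (σ : 𝟙_ C ⟶ B) (g : R ⟶ 𝟙_ C) (p : ℝ), p ≠ 0 →
      T.stateVector (Φ ≫ B ◁ g ≫ (ρ_ B).hom) = p • T.stateVector σ →
      ∀ i, prodState (ctrl i) σ ≫ K = prodState (ctrl i) (σ ≫ F i) := by
  have hn' : (n : ℝ)⁻¹ ≠ 0 := inv_ne_zero (Nat.cast_ne_zero.2 hn)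
  obtain ⟨e, he, hes⟩ := id hdist
  obtain ⟨E, ψ₀, b, hψ₀, hb₀, hψ₀d⟩ :=
    exists_steering_purification hc hp hn (fun i => (hctrl i).1) hes fun i => (hctrl i).1
  have hψ := hψ₀.comp_reversible (T.isReversible_braiding A E)
  set ψ := ψ₀ ≫ (β_ A E).hom with hψdef
  have hb : ∀ i, T.stateVector (ψ ≫ b i ▷ A ≫ (λ_ A).hom) = (n : ℝ)⁻¹ • T.stateVector (ctrl i) := by
    intro i
    rw [hψdef, Category.assoc, braiding_effect_left, hb₀]
  have hψd : T.stateVector (ψ ≫ discardLeft hc E A) =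
      ∑ i, (n : ℝ)⁻¹ • T.stateVector (ctrl i) := by
    rw [hψdef, Category.assoc, braiding_discardLeft, hψ₀d]
  have hΦF : ∀ i, T.IsPure (Φ ≫ F i ▷ R) := fun i => hΦ.comp_reversible ((hF i).whiskerRight R)
  obtain ⟨U, hU, hUs⟩ := hsymm (A ⊗ (B ⊗ R)) n (fun i => prodState (ctrl i) Φ)
    (fun i => prodState (ctrl i) (Φ ≫ F i ▷ R)) (fun i => hpure _ _ _ _ (hctrl i) hΦ)
    (hdist.prodState hc fun _ => hΦ.1) (fun i => hpure _ _ _ _ (hctrl i) (hΦF i))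
    (hdist.prodState hc fun i => (hΦF i).1)
  have hΨ := (hpure _ _ _ _ hψ hΦ).comp_reversible (T.isReversible_associator_hom E A (B ⊗ R))
  have hmarg := marginal_controlled_eq hc hp hpure hn he hes hF hψd hΦ hU hUs
  have hΨb : ∀ i, (prodState ψ Φ ≫ (α_ E A (B ⊗ R)).hom) ≫ b i ▷ (A ⊗ (B ⊗ R)) ≫
      (λ_ (A ⊗ (B ⊗ R))).hom = prodState (ψ ≫ b i ▷ A ≫ (λ_ A).hom) Φ := by
    intro i
    rw [Category.assoc, associator_effect_left, prodState_whiskerRight]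
  generalize prodState ψ Φ ≫ (α_ E A (B ⊗ R)).hom = Ψ at hΨ hmarg hΨb
  have hα : T.IsReversible (E ◁ (α_ A B R).inv) := (T.isReversible_associator_inv A B R).whiskerLeft E
  have hd : (α_ A B R).inv ≫ discardLeft hc (A ⊗ B) R =
      discardLeft hc A (B ⊗ R) ≫ discardLeft hc B R := by
    rw [discardLeft, discard_tensor, discardLeft, discardLeft]
    monoidal
  obtain ⟨K, hK, hKeq⟩ := exists_reversible_middle hc hp (hΨ.comp_reversible hα)
    ((hΨ.comp_reversible (hU.whiskerLeft E)).comp_reversible hα) (by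
      simp only [Category.assoc, ← whiskerLeft_comp, hd]
      simpa only [whiskerLeft_comp] using hmarg.symm)
  refine ⟨K, hK, fun σ g p hp0 hg i => ?_⟩
  -- Condition both sides on `b i` at `E`, which prepares `ctrl i`, and on `g` at `R`, which
  -- prepares `σ`.
  have h1 := congrArg (· ≫ (b i ▷ ((A ⊗ B) ⊗ R) ≫ (λ_ ((A ⊗ B) ⊗ R)).hom) ≫
    (A ⊗ B) ◁ g ≫ (ρ_ (A ⊗ B)).hom) hKeq
  have h2 : ∀ {Y : C} (f : A ⊗ (B ⊗ R) ⟶ (A ⊗ B) ⊗ R) (h : (A ⊗ B) ⊗ R ⟶ Y),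
      Ψ ≫ E ◁ f ≫ b i ▷ ((A ⊗ B) ⊗ R) ≫ (λ_ ((A ⊗ B) ⊗ R)).hom ≫ h =
        prodState (ψ ≫ b i ▷ A ≫ (λ_ A).hom) Φ ≫ f ≫ h := by
    intro Y f h
    have h3 := whiskerLeft_effect_left (b i) f
    rw [← hΨb, reassoc_of% h3]
    simp only [Category.assoc]
  have h4 : (α_ A B R).inv ≫ (A ⊗ B) ◁ g ≫ (ρ_ (A ⊗ B)).hom = A ◁ (B ◁ g ≫ (ρ_ B).hom) := by
    monoidal
  have h5 : K ▷ R ≫ (A ⊗ B) ◁ g ≫ (ρ_ (A ⊗ B)).hom =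
      ((A ⊗ B) ◁ g ≫ (ρ_ (A ⊗ B)).hom) ≫ K := by
    rw [← whisker_exchange_assoc, rightUnitor_naturality, Category.assoc]
  have h6 : prodState (ψ ≫ b i ▷ A ≫ (λ_ A).hom) (Φ ≫ B ◁ g ≫ (ρ_ B).hom) ≫ K =
      prodState (ψ ≫ b i ▷ A ≫ (λ_ A).hom) Φ ≫ U ≫ A ◁ (B ◁ g ≫ (ρ_ B).hom) := by
    have h7 : (Ψ ≫ E ◁ ((α_ A B R).inv ≫ K ▷ R)) ≫ (b i ▷ ((A ⊗ B) ⊗ R) ≫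
        (λ_ ((A ⊗ B) ⊗ R)).hom) ≫ (A ⊗ B) ◁ g ≫ (ρ_ (A ⊗ B)).hom =
        (Ψ ≫ E ◁ (U ≫ (α_ A B R).inv)) ≫ (b i ▷ ((A ⊗ B) ⊗ R) ≫
        (λ_ ((A ⊗ B) ⊗ R)).hom) ≫ (A ⊗ B) ◁ g ≫ (ρ_ (A ⊗ B)).hom := by
      simpa only [whiskerLeft_comp, Category.assoc] using h1
    simp only [Category.assoc, h2] at h7
    rw [h5, h4, ← Category.assoc (α_ A B R).inv, h4, ← Category.assoc, prodState_whiskerLeft] at h7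
    exact h7
  -- Both sides carry the same nonzero weights `n⁻¹` and `p`, which cancel at the end.
  have hl := T.stateVector_comp_of_eq_smul (T.stateVector_prodState_of_eq_smul_left (hb i)
    (Φ ≫ B ◁ g ≫ (ρ_ B).hom)) K
  rw [T.stateVector_comp_of_eq_smul (T.stateVector_prodState_of_eq_smul_right (ctrl i) hg), h6,
    T.stateVector_comp_of_eq_smul (T.stateVector_prodState_of_eq_smul_left (hb i) Φ)] at hl
  have h8 : F i ▷ R ≫ B ◁ g ≫ (ρ_ B).hom = (B ◁ g ≫ (ρ_ B).hom) ≫ F i := by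
    rw [← whisker_exchange_assoc, rightUnitor_naturality, Category.assoc]
  rw [← Category.assoc (prodState _ _) U, hUs, prodState_whiskerLeft, Category.assoc, h8,
    ← Category.assoc Φ, T.stateVector_prodState_of_eq_smul_right (ctrl i)
      (T.stateVector_comp_of_eq_smul hg (F i))] at hl
  exact T.stateVector_injective
    (smul_right_injective _ hp0 (smul_right_injective _ hn' hl)).symm

variable (T) in
/-- Finitely many states of a system span all of them. -/
lemma exists_spanning_states (B : C) : ∃ (m : ℕ) (σ : Fin m → (𝟙_ C ⟶ B)),
    (∀ k, T.IsState (σ k)) ∧ ∀ s : 𝟙_ C ⟶ B,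
      ∃ c : Fin m → ℝ, T.stateVector s = ∑ k, c k • T.stateVector (σ k) := by
  have hfg := Module.Finite.iff_fg.1 (T.finiteDimensional B)
  obtain ⟨t, htsub, ht⟩ := Submodule.fg_span_iff_fg_span_finset_subset _ |>.1 hfg
  choose r hr using fun x : t => htsub x.2
  -- The finite generating set consists of preparation events; rescaling makes them states.
  choose c σ hσ hm using fun x : t => T.normalize (r x)
  let eqv := t.equivFin.symm
  refine ⟨t.card, fun k => σ (eqv k), fun k => hσ _, fun s => ?_⟩
  have hs : T.stateVector s ∈ Submodule.span ℝ (Set.range fun k => T.stateVector (σ (eqv k))) := by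
    have hst : T.stateVector s ∈ Submodule.span ℝ (t : Set ((B ⟶ 𝟙_ C) → ℝ)) :=
      ht ▸ Submodule.subset_span ⟨s, rfl⟩
    refine Submodule.span_le.2 ?_ hst
    intro x hx
    have h1 := stateVector_of_isMultiple (hm ⟨x, hx⟩)
    rw [hr] at h1
    rw [SetLike.mem_coe, show x = _ from h1]
    exact Submodule.smul_mem _ _ (Submodule.subset_span ⟨eqv.symm ⟨x, hx⟩, by simp⟩)
  obtain ⟨a, ha⟩ := (Submodule.mem_span_range_iff_exists_fun ℝ).1 hs
  exact ⟨a, ha.symm⟩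

lemma exists_controlled_endo (hc : T.Causality) (hp : T.Purification)
    (hsymm : T.StrongSymmetry) (hpure : T.PureComposites)
    {A B : C} {n : ℕ} (hn : 2 ≤ n) {ctrl : Fin n → (𝟙_ C ⟶ A)} (hctrl : ∀ i, T.IsPure (ctrl i))
    (hdist : T.PerfectlyDistinguishable ctrl) {F : Fin n → (B ⟶ B)}
    (hF : ∀ i, T.IsReversible (F i)) :
    ∃ K : A ⊗ B ⟶ A ⊗ B, T.IsReversible K ∧ T.IsControlled ctrl F K := by
  obtain ⟨m, σ, hσ, hspan⟩ := T.exists_spanning_states B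
  rcases eq_or_ne m 0 with rfl | hm
  -- An empty spanning family means that `B` has no states: a state has probability one under
  -- discarding. The requirement is then vacuous.
  · refine ⟨A ◁ F ⟨0, by omega⟩, (hF _).whiskerLeft A, fun i s hs => ?_⟩
    obtain ⟨c, h⟩ := hspan s
    have h1 := congrFun h (discard hc B)
    simp [CircuitProbability.stateVector, state_comp_discard hc hs, prob_id] at h1
  obtain ⟨e, -, hes⟩ := id hdist
  -- Here `2 ≤ n` is needed: two control states supply the bit from which the register is built.
  obtain ⟨S, t, f, ht, hf⟩ := exists_distinguishable_family hc
    (s := fun i => ctrl (Fin.castLE hn i)) (fun i => (hctrl _).1)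
    (e := fun j => e (Fin.castLE hn j)) (fun i j => by simp [hes]) m
  obtain ⟨R, Φ, g, hΦ, hg, -⟩ := exists_steering_purification hc hp hm ht hf hσ
  obtain ⟨K, hK, hKs⟩ :=
    exists_controlled_of_steering hc hp hsymm hpure (by omega) hctrl hdist hF hΦ
  refine ⟨K, hK, fun i s _ => T.stateVector_injective ?_⟩
  obtain ⟨c, hs⟩ := hspan s
  rw [prodState_eq_right, prodState_eq_right, Category.assoc, Category.assoc, Category.assoc,
    T.stateVector_comp_of_eq_sum hs, T.stateVector_comp_of_eq_sum hs]
  refine Finset.sum_congr rfl fun k _ => ?_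
  have h1 := hKs (σ k) (g k) _ (inv_ne_zero (Nat.cast_ne_zero.2 hm)) (hg k) i
  rw [prodState_eq_right, prodState_eq_right, Category.assoc, Category.assoc, Category.assoc] at h1
  rw [h1]

end Control

end OperationalTheory

theorem mainTheorem1 {C : Type u} [Category.{v} C] [MonoidalCategory C] [SymmetricCategory C]
    (T : OperationalTheory C) (hcausal : T.Causality) (hpur : T.Purification)
    (hsymm : T.StrongSymmetry) (hpure : T.PureComposites)
    {A B B' : C} {n : ℕ} (hn : 1 ≤ n)
    (ctrl : Fin n → (𝟙_ C ⟶ A)) (hctrl : ∀ i, T.IsPure (ctrl i))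
    (hdist : T.PerfectlyDistinguishable ctrl)
    (F : Fin n → (B ⟶ B')) (hF : ∀ i, T.IsReversible (F i)) :
    ∃ K : A ⊗ B ⟶ A ⊗ B', T.IsReversible K ∧ T.IsControlled ctrl F K := by
  open OperationalTheory in
  obtain ⟨hF₀, G, hG, hFG, hGF⟩ := hF ⟨0, hn⟩
  rcases hn.eq_or_lt with rfl | hn2
  · refine ⟨A ◁ F ⟨0, hn⟩, (hF _).whiskerLeft A, fun i s _ => ?_⟩
    rw [prodState_whiskerLeft, show i = ⟨0, hn⟩ by omega]
  · obtain ⟨K, hK, hKs⟩ := exists_controlled_endo hcausal hpur hsymm hpure hn2 hctrl hdist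
      -- Composing with `G`, the inverse of the first transformation, brings the target back to `B`;
      -- applying that transformation after `K` undoes this.
      (F := fun i => F i ≫ G) fun i => (hF i).comp ⟨hG, _, hF₀, hGF, hFG⟩
    refine ⟨K ≫ A ◁ F ⟨0, hn⟩, hK.comp ((hF _).whiskerLeft A), fun i s hs => ?_⟩
    rw [← Category.assoc, hKs i s hs, prodState_whiskerLeft, Category.assoc, Category.assoc, hGF,
      Category.comp_id]
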